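/- Let $G$ be a compact Lie group with normalised Haar measure $\mu$, and let $\widehat G$ be the set of equivalence classes of irreducible unitary representations $\pi:G\to U(d_\pi)$. For $f\in L^1(G)$ put $\hat f(\pi)=\int_G f(g)\pi(g)^*\,d\mu(g)$, $\check f(g)=\overline{f(g^{-1})}$ and $f*k(g)=\int_G f(h)k(h^{-1}g)\,d\mu(h)$. Let $\widehat G_+\subset\widehat G$ be co-finite and let $L^2_0(G)=\bigoplus_{\pi\in\widehat G_+}\mathcal H_\pi\subset L^2(G)$ (Hilbert space direct sum), where $\mathcal H_\pi=\{g\mapsto\operatorname{tr}(\pi(g)A):A\in\mathbb C^{d_\pi\times d_\pi}\}$. Write $\mathbb R_+=(0,\infty)$. Let $(p_t)_{t>0}$ be a diffusive approximate identity with respect to $\widehat G_+$, i.e. $p\in C^1(\mathbb R_+;L^1(G))$ such that: $\|\hat p_t(\pi)\|\le C$ (operator norm) uniformly in $t>0$ and $\pi\in\widehat G$; $\lim_{t\to0}\hat p_t(\pi)=\mathrm I$ for all $\pi\in\widehat G$; $\lim_{t\to\infty}\hat p_t(\pi)=0$ for all $\pi\in\widehat G_+$; and $-\partial_t\hat p_t(\pi)$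 is positive semidefinite for all $t>0$, $\pi\in\widehat G_+$. Let $\alpha:\mathbb R_+\to(0,\infty)$ be a measurable weight, and let $\rho\mapsto\psi_\rho\in L^2_0(G)$, $\rho>0$, be a (measurable) diffusive wavelet family, i.e. $$p_t\big|_{\widehat G_+}=\int_t^\infty\check\psi_\rho*\psi_\rho\,\alpha(\rho)\,d\rho\qquad\text{for all }t>0,$$ where $p_t|_{\widehat G_+}$ has the Fourier coefficients $\hat p_t(\pi)$ for $\pi\in\widehat G_+$ and $0$ otherwise, and the integral is understood weakly, i.e. Fourier coefficient by Fourier coefficient. Assume that every $\psi_\rho$ is central, that is, $\psi_\rho(ghg^{-1})=\psi_\rho(h)$ for each $g\in G$ and almost every $h\in G$. Let $X$ be a Hausdorff space with a continuous transitive action of $G$ and a base point $x_0$. Let $dx$ be the measure on $X$ with $\int_X\phi(x)\,dx=\int_G\phi(g\cdot x_0)\,d\mu(g)$, and let $L^2_0(X)$ be the space of all $\phi\in L^2(X)$ for which $g\mapsto\phi(g\cdot x_0)$ belongs to $L^2_0(G)$. Then for all $\phi\in L^2_0(X)$, $\rho>0$ and $x\in X$ the integral $$W_X\phi(\rho,x)=\int_G\phi(h\cdot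 x)\,\overline{\psi_\rho(h)}\,d\mu(h)$$ converges absolutely, and the zonal wavelet transform $W_X$ is a linear isometry $$W_X:L^2_0(X)\to L^2(\mathbb R_+\times X,\ \alpha(\rho)\,d\rho\otimes dx);$$ in particular $\langle W_X\phi_1,W_X\phi_2\rangle=\langle\phi_1,\phi_2\rangle$ for all $\phi_1,\phi_2\in L^2_0(X)$, i.e. $W_X$ is unitary onto its range. -/

import Mathlib

open MeasureTheory Set Filter Topology
open scoped Matrix Manifold ContDiff ComplexOrder

/-- An irreducible unitary representation of a topological group by unitary `d × d` matrices,
`d ≥ 1`: only the scalar matrices commute with all `π(g)`. -/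
structure UnitaryIrrep (G : Type*) [Group G] [TopologicalSpace G] where
  /-- the dimension `d_π` -/
  dim : ℕ
  dim_pos : 0 < dim
  /-- the representation itself -/
  hom : G →* Matrix.unitaryGroup (Fin dim) ℂ
  continuous_hom : Continuous hom
  irreducible : ∀ A : Matrix (Fin dim) (Fin dim) ℂ,
    (∀ g : G, (hom g : Matrix (Fin dim) (Fin dim) ℂ) * A =
      A * (hom g : Matrix (Fin dim) (Fin dim) ℂ)) →
    ∃ c : ℂ, A = c • (1 : Matrix (Fin dim) (Fin dim) ℂ)

namespace UnitaryIrrep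

variable {G : Type*} [Group G] [TopologicalSpace G]

/-- The matrix `π(g)`. -/
def mat (π : UnitaryIrrep G) (g : G) : Matrix (Fin π.dim) (Fin π.dim) ℂ :=
  (π.hom g : Matrix (Fin π.dim) (Fin π.dim) ℂ)

/-- Equivalence of representations: `π₁(g) A = A π₂(g)` for an invertible matrix `A`. -/
def Equivalent (π₁ π₂ : UnitaryIrrep G) : Prop :=
  ∃ (A : Matrix (Fin π₁.dim) (Fin π₂.dim) ℂ) (B : Matrix (Fin π₂.dim) (Fin π₁.dim) ℂ),
    A * B = 1 ∧ B * A = 1 ∧ ∀ g : G, π₁.mat g * A = A * π₂.mat g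

theorem equivalent_equivalence :
    Equivalence (Equivalent : UnitaryIrrep G → UnitaryIrrep G → Prop) where
  refl π := ⟨1, 1, by simp, by simp, by simp⟩
  symm := by
    rintro π₁ π₂ ⟨A, B, hAB, hBA, h⟩
    refine ⟨B, A, hBA, hAB, fun g => ?_⟩
    calc π₂.mat g * B = B * A * π₂.mat g * B := by rw [hBA, one_mul]
      _ = B * (A * π₂.mat g) * B := by rw [Matrix.mul_assoc B A]
      _ = B * (π₁.mat g * A) * B := by rw [h g]
      _ = B * π₁.mat g * (A * B) := by simp only [Matrix.mul_assoc]
      _ = B * π₁.mat g := by rw [hAB, Matrix.mul_one]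
  trans := by
    rintro π₁ π₂ π₃ ⟨A, B, hAB, hBA, h⟩ ⟨C, D, hCD, hDC, k⟩
    refine ⟨A * C, D * B, ?_, ?_, fun g => ?_⟩
    · calc A * C * (D * B) = A * (C * D) * B := by simp only [Matrix.mul_assoc]
        _ = 1 := by rw [hCD, Matrix.mul_one, hAB]
    · calc D * B * (A * C) = D * (B * A) * C := by simp only [Matrix.mul_assoc]
        _ = 1 := by rw [hBA, Matrix.mul_one, hDC]
    · rw [← Matrix.mul_assoc, h g, Matrix.mul_assoc, k g, Matrix.mul_assoc]

end UnitaryIrrep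

instance unitaryIrrepSetoid (G : Type*) [Group G] [TopologicalSpace G] :
    Setoid (UnitaryIrrep G) :=
  ⟨UnitaryIrrep.Equivalent, UnitaryIrrep.equivalent_equivalence⟩

/-- The unitary dual `Ĝ`: equivalence classes of irreducible unitary representations. -/
def UnitaryDual (G : Type*) [Group G] [TopologicalSpace G] : Type _ :=
  Quotient (unitaryIrrepSetoid G)

/-- The class of `π` in `Ĝ`. -/
def UnitaryIrrep.cls {G : Type*} [Group G] [TopologicalSpace G] (π : UnitaryIrrep G) :
    UnitaryDual G :=
  Quotient.mk (unitaryIrrepSetoid G) π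

noncomputable section

section Group

variable {G : Type*} [Group G] [TopologicalSpace G] [MeasurableSpace G]

/-- The group Fourier coefficient `∫ f(g) π(g)* dμ(g)`, a `d_π × d_π` matrix. -/
def groupFourier (μ : Measure G) (f : G → ℂ) (π : UnitaryIrrep G) :
    Matrix (Fin π.dim) (Fin π.dim) ℂ :=
  Matrix.of fun i j => ∫ g, f g * (π.mat g)ᴴ i j ∂μ

/-- Group convolution `(f * k)(g) = ∫ f(h) k(h⁻¹ g) dμ(h)`. -/
def groupConv (μ : Measure G) (f k : G → ℂ) : G → ℂ :=
  fun g => ∫ h, f h * k (h⁻¹ * g) ∂μ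

/-- The involution: the conjugate of `f(g⁻¹)`. -/
def groupCheck (f : G → ℂ) : G → ℂ := fun g => star (f g⁻¹)

/-- `H_π`, the space of the functions `g ↦ trace (π(g) A)`, as a subspace of `L²(G)`. -/
def coeffSpace (μ : Measure G) (π : UnitaryIrrep G) : Submodule ℂ (Lp ℂ 2 μ) where
  carrier := {f | ∃ A : Matrix (Fin π.dim) (Fin π.dim) ℂ,
    (f : G → ℂ) =ᵐ[μ] fun g => (π.mat g * A).trace}
  zero_mem' := ⟨0, by filter_upwards [Lp.coeFn_zero ℂ 2 μ] with g hg; rw [hg]; simp⟩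
  add_mem' := by
    rintro f k ⟨A, hA⟩ ⟨B, hB⟩
    refine ⟨A + B, ?_⟩
    filter_upwards [Lp.coeFn_add f k, hA, hB] with g h1 h2 h3
    rw [h1, Pi.add_apply, h2, h3, Matrix.mul_add, Matrix.trace_add]
  smul_mem' := by
    rintro c f ⟨A, hA⟩
    refine ⟨c • A, ?_⟩
    filter_upwards [Lp.coeFn_smul c f, hA] with g h1 h2
    rw [h1, Pi.smul_apply, h2, Matrix.mul_smul, Matrix.trace_smul]

/-- `L²₀(G)`: the Hilbert space direct sum of the `H_π` over `[π] ∈ Ĝ₊`, that is, the closure in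
`L²(G)` of their algebraic sum. -/
def L2ZeroGroup (μ : Measure G) (Gp : Set (UnitaryDual G)) : Submodule ℂ (Lp ℂ 2 μ) :=
  (⨆ π : {π : UnitaryIrrep G // π.cls ∈ Gp}, coeffSpace μ π.1).topologicalClosure

/-- `p` is a diffusive approximate identity with respect to the co-finite set `Ĝ₊` of classes of
representations; `ℝ₊` is the open half-line, and the norm in `bounded` is the operator norm for the
Euclidean norm. -/
structure IsDiffusiveApproxIdentity (μ : Measure G) (Gp : Set (UnitaryDual G))
    (p : ℝ → Lp ℂ 1 μ) : Prop where
  cofinite : Gpᶜ.Finite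
  contDiffOn : ContDiffOn ℝ 1 p (Ioi 0)
  bounded : ∃ C : ℝ, ∀ π : UnitaryIrrep G, ∀ t : ℝ, 0 < t →
    ‖Matrix.toEuclideanCLM (n := Fin π.dim) (𝕜 := ℂ) (groupFourier μ (p t) π)‖ ≤ C
  tendsto_zero : ∀ π : UnitaryIrrep G,
    Tendsto (fun t : ℝ => groupFourier μ (p t) π) (𝓝[>] 0) (𝓝 1)
  tendsto_atTop : ∀ π : UnitaryIrrep G, π.cls ∈ Gp →
    Tendsto (fun t : ℝ => groupFourier μ (p t) π) atTop (𝓝 0)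
  posSemidef : ∀ π : UnitaryIrrep G, π.cls ∈ Gp → ∀ t : ℝ, 0 < t →
    Matrix.PosSemidef (Matrix.of fun i j => -deriv (fun s : ℝ => groupFourier μ (p s) π i j) t)

open Classical in
/-- `ψ` is a diffusive wavelet family for `p` and the weight `α`: it is a (measurable) family in
`L²₀(G)` with `p_t|_{Ĝ₊} = ∫_t^∞ ψ̌_ρ * ψ_ρ α(ρ) dρ` for all `t > 0`.

The distribution `p_t|_{Ĝ₊}` has the Fourier coefficients of `p_t` on `Ĝ₊` and the coefficients `0`
elsewhere. The integral of functions is a weak integral: it is tested against the matrix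
coefficients of the irreducible representations. Since the Fourier matrices of `ψ̌_ρ * ψ_ρ` are
positive semidefinite, convergence of the improper integrals is the same as integrability. An
integral that converges in `L¹(G)`, in `L²(G)` or in the sense of distributions is a weak integral
in this sense. -/
structure IsDiffusiveWaveletFamily (μ : Measure G) (Gp : Set (UnitaryDual G))
    (p : ℝ → Lp ℂ 1 μ) (α : ℝ → ℝ) (ψ : ℝ → Lp ℂ 2 μ) : Prop where
  mem : ∀ ρ : ℝ, 0 < ρ → ψ ρ ∈ L2ZeroGroup μ Gp
  aestronglyMeasurable : AEStronglyMeasurable ψ (volume.restrict (Ioi 0))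
  integrableOn : ∀ t : ℝ, 0 < t → ∀ (π : UnitaryIrrep G) (i j : Fin π.dim),
    IntegrableOn
      (fun ρ : ℝ => groupFourier μ (groupConv μ (groupCheck (ψ ρ)) (ψ ρ)) π i j * (α ρ : ℂ)) (Ioi t)
  admissible : ∀ t : ℝ, 0 < t → ∀ (π : UnitaryIrrep G) (i j : Fin π.dim),
    ∫ ρ in Ioi t, groupFourier μ (groupConv μ (groupCheck (ψ ρ)) (ψ ρ)) π i j * (α ρ : ℂ) =
      if π.cls ∈ Gp then groupFourier μ (p t) π i j else 0

/-- A (class of a) function on `G` is central if it is invariant under all conjugations. -/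
def IsCentral (μ : Measure G) (f : Lp ℂ 2 μ) : Prop :=
  ∀ g : G, ∀ᵐ h ∂μ, f (g * h * g⁻¹) = f h

end Group

section Homogeneous

variable {G : Type*} [Group G] [TopologicalSpace G] [MeasurableSpace G] [OpensMeasurableSpace G]
  {X : Type*} [TopologicalSpace X] [MeasurableSpace X] [BorelSpace X]
  [MulAction G X] [ContinuousSMul G X]

/-- The measure `dx` on `X` with `∫ φ(x) dx = ∫ φ(g • x₀) dμ(g)`. -/
def orbitMeasure (μ : Measure G) (x₀ : X) : Measure X :=
  μ.map fun g : G => g • x₀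

theorem measurePreserving_orbit (μ : Measure G) (x₀ : X) :
    MeasurePreserving (fun g : G => g • x₀) μ (orbitMeasure μ x₀) :=
  ⟨(continuous_id.smul continuous_const).measurable, rfl⟩

/-- The lift `φ ↦ φ̃`, `φ̃(g) = φ(g • x₀)`, from `L²(X)` to `L²(G)`. -/
def orbitLift (μ : Measure G) (x₀ : X) : Lp ℂ 2 (orbitMeasure μ x₀) →ₗ[ℂ] Lp ℂ 2 μ :=
  Lp.compMeasurePreservingₗ ℂ (fun g : G => g • x₀) (measurePreserving_orbit μ x₀)

/-- `L²₀(X)`: the functions in `L²(X)` whose lift to `G` lies in `L²₀(G)`. -/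
def L2ZeroSpace (μ : Measure G) (Gp : Set (UnitaryDual G)) (x₀ : X) :
    Submodule ℂ (Lp ℂ 2 (orbitMeasure μ x₀)) :=
  (L2ZeroGroup μ Gp).comap (orbitLift μ x₀)

/-- The zonal wavelet transform
`W_X φ(ρ, x) = ∫ φ(h • x) conj(ψ_ρ(h)) dμ(h)`. -/
def zonalTransform (μ : Measure G) (ψ : ℝ → Lp ℂ 2 μ) (φ : X → ℂ) (ρ : ℝ) (x : X) : ℂ :=
  ∫ h, φ (h • x) * star (ψ ρ h) ∂μ

/-- The measure `α(ρ) dρ` on `ℝ₊`, as a measure on `ℝ` carried by the open half-line. -/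
def scaleMeasure (α : ℝ → ℝ) : Measure ℝ :=
  (volume.restrict (Ioi 0)).withDensity fun ρ => ENNReal.ofReal (α ρ)

end Homogeneous

end

/-! A central `ψ_ρ` has, by irreducibility, a scalar Fourier coefficient `c_ρ(π) I` at every `π`.
Hence on `H_π` the group transform `(ρ, g) ↦ ⟨ψ_ρ, f(· g)⟩` is multiplication: it sends `f` to the
pure tensor `conj (c_ρ(π)) f(g)`. The Fourier matrix of `ψ̌_ρ * ψ_ρ` is `|c_ρ(π)|² I`, so
admissibility together with `p̂_t(π) → I` as `t → 0` gives `∫ |c_ρ(π)|² α(ρ) dρ = 1` on `Ĝ₊`, which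
is the isometry on a single `H_π`.

For `f ∈ H_π` and `k ∈ H_σ` the inner product of the transforms is a scale integral times an inner
product in `L²(G)`. Either `c_ρ(π) = c_ρ(σ)` for all `ρ > 0`, and the scale integral is `1`, or some
`ψ_ρ` separates the two representations, and this alone makes `H_π` and `H_σ` orthogonal
(`inner_eq_zero_of_groupFourier_ne`). Orthogonality is thus never derived from inequivalence, and no
choice of class representatives is needed.

Fatou's lemma and the triangle inequality carry the isometry from the algebraic sum to its closure
`L²₀(G)`. On `X`, `W_X φ(ρ, g • x₀)` is the group transform of the lift of `φ`, and lifting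
preserves `L²` norms. -/

noncomputable section

/-! ### Unimodularity of compact groups -/

section CompactGroup

variable {G : Type*} [Group G] [TopologicalSpace G] [IsTopologicalGroup G] [CompactSpace G]
  [MeasurableSpace G] [BorelSpace G] (μ : Measure G) [μ.IsHaarMeasure] [IsProbabilityMeasure μ]

/-- The normalised Haar measure of a compact group is the only left invariant probability
measure. -/
theorem eq_haar_of_isMulLeftInvariant (ν : Measure G) [ν.IsMulLeftInvariant]
    [IsProbabilityMeasure ν] : ν = μ := by
  have h := Measure.isMulInvariant_eq_smul_of_compactSpace ν μ
  have h1 := congrArg (fun m : Measure G => m univ) h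
  simp only [Measure.smul_apply, measure_univ] at h1
  rw [h]
  have h2 : Measure.haarScalarFactor ν μ = 1 := by
    rw [ENNReal.smul_def, smul_eq_mul, mul_one] at h1
    exact_mod_cast h1.symm
  rw [h2, one_smul]

/-- Left and right translations commute, so a right translate of `μ` is again a left invariant
probability measure, and uniqueness applies. -/
theorem isMulRightInvariant_haar_of_compactSpace : μ.IsMulRightInvariant := by
  refine ⟨fun g => ?_⟩
  have : IsProbabilityMeasure (μ.map (· * g)) :=
    Measure.isProbabilityMeasure_map (measurable_mul_const g).aemeasurable
  exact eq_haar_of_isMulLeftInvariant μ _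

/-- Inversion exchanges left and right invariance; uniqueness applies once more. -/
theorem isInvInvariant_haar_of_compactSpace : μ.IsInvInvariant := by
  have := isMulRightInvariant_haar_of_compactSpace μ
  have : IsProbabilityMeasure μ.inv := by
    unfold Measure.inv
    exact Measure.isProbabilityMeasure_map measurable_inv.aemeasurable
  exact ⟨eq_haar_of_isMulLeftInvariant μ _⟩

end CompactGroup

/-! ### Matrix entries of unitary representations -/

namespace UnitaryIrrep

variable {G : Type*} [Group G] [TopologicalSpace G] (π : UnitaryIrrep G)

theorem mat_mul (g h : G) : π.mat (g * h) = π.mat g * π.mat h := by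
  simp [mat]

theorem mat_inv (g : G) : π.mat g⁻¹ = (π.mat g)ᴴ := by
  simp [mat, Matrix.star_eq_conjTranspose]

theorem continuous_mat : Continuous π.mat :=
  continuous_subtype_val.comp π.continuous_hom

theorem continuous_mat_apply (i j : Fin π.dim) : Continuous fun g => π.mat g i j :=
  π.continuous_mat.matrix_elem i j

theorem norm_mat_apply_le (g : G) (i j : Fin π.dim) : ‖π.mat g i j‖ ≤ 1 :=
  entry_norm_bound_of_unitary (π.hom g).2 i j

/-- An index of the representation space. -/
def index : Fin π.dim := ⟨0, π.dim_pos⟩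

end UnitaryIrrep

/-! ### Fourier coefficients of central functions and of `f̌ * f` -/

section FourierCoefficients

variable {G : Type*} [Group G] [TopologicalSpace G] [MeasurableSpace G] {μ : Measure G}

theorem integral_star_mul_mat (π : UnitaryIrrep G) (f : G → ℂ) (i j : Fin π.dim) :
    ∫ g, star (f g) * π.mat g i j ∂μ = (groupFourier μ f π)ᴴ i j := by
  rw [Matrix.conjTranspose_apply, groupFourier, Matrix.of_apply, Complex.star_def, ← integral_conj]
  simp [Matrix.conjTranspose_apply]

variable [BorelSpace G]

theorem UnitaryIrrep.integrable_mul_mat (π : UnitaryIrrep G) {f : G → ℂ} (hf : Integrable f μ)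
    (i j : Fin π.dim) : Integrable (fun g => f g * π.mat g i j) μ :=
  hf.mul_bdd (c := 1) (π.continuous_mat_apply i j).measurable.aestronglyMeasurable
    (ae_of_all _ fun g => π.norm_mat_apply_le g i j)

theorem UnitaryIrrep.integrable_mul_mat_conjTranspose (π : UnitaryIrrep G) {f : G → ℂ}
    (hf : Integrable f μ) (i j : Fin π.dim) : Integrable (fun g => f g * (π.mat g)ᴴ i j) μ :=
  hf.mul_bdd (c := 1)
    (continuous_star.comp (π.continuous_mat_apply j i)).measurable.aestronglyMeasurable
    (ae_of_all _ fun g => by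
      rw [Matrix.conjTranspose_apply, norm_star]; exact π.norm_mat_apply_le g j i)

theorem mul_groupFourier_apply (π : UnitaryIrrep G) {f : G → ℂ} (hf : Integrable f μ) {m : Type*}
    (A : Matrix m (Fin π.dim) ℂ) (i : m) (j : Fin π.dim) :
    (A * groupFourier μ f π) i j = ∫ g, f g * (A * (π.mat g)ᴴ) i j ∂μ := by
  simp only [Matrix.mul_apply, groupFourier, Matrix.of_apply, Finset.mul_sum]
  rw [integral_finsetSum]
  · refine Finset.sum_congr rfl fun k _ => ?_
    rw [← integral_const_mul]
    exact integral_congr_ae (ae_of_all _ fun g => mul_left_comm _ _ _)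
  · intro k _
    exact ((π.integrable_mul_mat_conjTranspose hf k j).const_mul (A i k)).congr
      (ae_of_all _ fun g => mul_left_comm _ _ _)

theorem groupFourier_mul_apply (π : UnitaryIrrep G) {f : G → ℂ} (hf : Integrable f μ) {m : Type*}
    (A : Matrix (Fin π.dim) m ℂ) (i : Fin π.dim) (j : m) :
    (groupFourier μ f π * A) i j = ∫ g, f g * ((π.mat g)ᴴ * A) i j ∂μ := by
  simp only [Matrix.mul_apply, groupFourier, Matrix.of_apply, Finset.mul_sum]
  rw [integral_finsetSum]
  · refine Finset.sum_congr rfl fun k _ => ?_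
    rw [← integral_mul_const]
    exact integral_congr_ae (ae_of_all _ fun g => mul_assoc _ _ _)
  · intro k _
    exact ((π.integrable_mul_mat_conjTranspose hf i k).mul_const (A k j)).congr
      (ae_of_all _ fun g => mul_assoc _ _ _)

variable [IsTopologicalGroup G]

/-- The Fourier coefficients of a central function are scalar. -/
theorem groupFourier_eq_smul_one_of_isCentral [μ.IsMulLeftInvariant] [μ.IsMulRightInvariant]
    [IsFiniteMeasure μ]
    {f : Lp ℂ 2 μ} (hf : IsCentral μ f) (π : UnitaryIrrep G) :
    groupFourier μ f π =
      groupFourier μ f π π.index π.index • (1 : Matrix (Fin π.dim) (Fin π.dim) ℂ) := by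
  have hi : Integrable f μ := (Lp.memLp f).integrable (by norm_num)
  obtain ⟨c, hc⟩ := π.irreducible (groupFourier μ f π) fun g => by
    change π.mat g * groupFourier μ f π = groupFourier μ f π * π.mat g
    ext i j
    -- The two translations replace `h` by `g h g⁻¹`; then `π(g h g⁻¹)* π(g) = π(g) π(h)*`, while
    -- centrality leaves `f` unchanged.
    rw [mul_groupFourier_apply π hi, groupFourier_mul_apply π hi,
      ← integral_mul_left_eq_self (fun h => f h * ((π.mat h)ᴴ * π.mat g) i j) g,
      ← integral_mul_right_eq_self (fun h => f (g * h) * ((π.mat (g * h))ᴴ * π.mat g) i j) g⁻¹]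
    refine integral_congr_ae ?_
    filter_upwards [hf g] with h hh
    have h1 : (π.mat g)ᴴ * π.mat g = 1 := by
      rw [← π.mat_inv, ← π.mat_mul]; simp [UnitaryIrrep.mat]
    rw [← mul_assoc, hh, π.mat_mul, π.mat_mul, π.mat_inv, Matrix.conjTranspose_mul,
      Matrix.conjTranspose_mul, Matrix.conjTranspose_conjTranspose, Matrix.mul_assoc,
      Matrix.mul_assoc, h1, Matrix.mul_one]
  rw [hc]
  simp

variable [SecondCountableTopology G]

/-- The Fourier coefficients of `f̌ * f` are `f̂(π) f̂(π)*`. -/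
theorem groupFourier_groupConv_groupCheck [μ.IsMulLeftInvariant] [μ.IsInvInvariant] [SFinite μ]
    {f : G → ℂ} (hf : Integrable f μ) (π : UnitaryIrrep G) :
    groupFourier μ (groupConv μ (groupCheck f) f) π =
      groupFourier μ f π * (groupFourier μ f π)ᴴ := by
  have hs : Integrable (fun g => star (f g)) μ :=
    (LinearIsometryEquiv.integrable_comp_iff Complex.conjLIE).2 hf
  have hc : Integrable (groupCheck f) μ := hs.comp_inv
  ext i j
  -- Justifies Fubini: `(h, g) ↦ (h, h⁻¹ g)` preserves the product measure, so this is the pullback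
  -- of an integrable product times an entry bounded by `1`.
  have hint : Integrable (fun z : G × G => groupCheck f z.1 * f (z.1⁻¹ * z.2) * (π.mat z.2)ᴴ i j)
      (μ.prod μ) := by
    refine Integrable.mul_bdd (c := 1)
      ((measurePreserving_prod_inv_mul μ μ).integrable_comp_of_integrable (hc.mul_prod hf)) ?_
      (ae_of_all _ fun z => ?_)
    · exact ((continuous_star.comp (π.continuous_mat_apply j i)).comp
        continuous_snd).measurable.aestronglyMeasurable
    · rw [Matrix.conjTranspose_apply, norm_star]; exact π.norm_mat_apply_le z.2 j i
  calc groupFourier μ (groupConv μ (groupCheck f) f) π i j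
      = ∫ g, ∫ h, groupCheck f h * f (h⁻¹ * g) * (π.mat g)ᴴ i j ∂μ ∂μ := by
        simp only [groupFourier, groupConv, Matrix.of_apply, integral_mul_const]
    _ = ∫ h, ∫ g, groupCheck f h * f (h⁻¹ * g) * (π.mat g)ᴴ i j ∂μ ∂μ :=
        (integral_integral_swap hint).symm
    _ = ∫ h, groupCheck f h * (groupFourier μ f π * (π.mat h)ᴴ) i j ∂μ := by
        refine integral_congr_ae (ae_of_all _ fun h => ?_)
        simp only [mul_assoc]
        rw [integral_const_mul, groupFourier_mul_apply π hf,
          ← integral_mul_left_eq_self (fun g => f (h⁻¹ * g) * (π.mat g)ᴴ i j) h]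
        simp only [inv_mul_cancel_left, π.mat_mul, Matrix.conjTranspose_mul]
    _ = ∫ h, star (f h) * (groupFourier μ f π * π.mat h) i j ∂μ := by
        rw [← integral_inv_eq_self]
        simp only [groupCheck, inv_inv, π.mat_inv, Matrix.conjTranspose_conjTranspose]
    _ = (groupFourier μ f π * (groupFourier μ f π)ᴴ) i j := by
        simp only [Matrix.mul_apply, Finset.mul_sum, ← integral_star_mul_mat]
        rw [integral_finsetSum]
        · refine Finset.sum_congr rfl fun k _ => ?_
          rw [← integral_const_mul]
          exact integral_congr_ae (ae_of_all _ fun g => mul_left_comm _ _ _)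
        · intro k _
          exact ((π.integrable_mul_mat hs k j).const_mul
            (groupFourier μ f π i k)).congr (ae_of_all _ fun g => mul_left_comm _ _ _)

end FourierCoefficients

/-! ### Orthogonality of matrix coefficients by averaging -/

theorem continuous_mat_mul_mul_conjTranspose {G : Type*} [Group G] [TopologicalSpace G]
    (π₁ π₂ : UnitaryIrrep G) (C : Matrix (Fin π₁.dim) (Fin π₂.dim) ℂ) :
    Continuous fun g => π₁.mat g * C * (π₂.mat g)ᴴ :=
  (π₁.continuous_mat.matrix_mul continuous_const).matrix_mul π₂.continuous_mat.matrix_conjTranspose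

section Orthogonality

variable {G : Type*} [Group G] [TopologicalSpace G] [CompactSpace G]
  [MeasurableSpace G] [BorelSpace G] {μ : Measure G}

/-- The average `∫ π₁(g) C π₂(g)* dμ(g)`, which intertwines `π₂` and `π₁`. -/
def schurAverage (μ : Measure G) (π₁ π₂ : UnitaryIrrep G)
    (C : Matrix (Fin π₁.dim) (Fin π₂.dim) ℂ) : Matrix (Fin π₁.dim) (Fin π₂.dim) ℂ :=
  Matrix.of fun i j => ∫ g, (π₁.mat g * C * (π₂.mat g)ᴴ) i j ∂μ

variable [IsFiniteMeasure μ] (π₁ π₂ : UnitaryIrrep G) (C : Matrix (Fin π₁.dim) (Fin π₂.dim) ℂ)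

theorem mul_schurAverage_apply (A : Matrix (Fin π₁.dim) (Fin π₁.dim) ℂ) (i : Fin π₁.dim)
    (j : Fin π₂.dim) : (A * schurAverage μ π₁ π₂ C) i j =
      ∫ g, (A * (π₁.mat g * C * (π₂.mat g)ᴴ)) i j ∂μ := by
  simp only [Matrix.mul_apply (M := A), schurAverage, Matrix.of_apply]
  rw [integral_finsetSum]
  · simp only [integral_const_mul]
  · intro k _
    exact (continuous_const.mul ((continuous_mat_mul_mul_conjTranspose π₁ π₂ C).matrix_elem
      k j)).integrable_of_hasCompactSupport (HasCompactSupport.of_compactSpace _)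

theorem schurAverage_mul_apply (A : Matrix (Fin π₂.dim) (Fin π₂.dim) ℂ) (i : Fin π₁.dim)
    (j : Fin π₂.dim) : (schurAverage μ π₁ π₂ C * A) i j =
      ∫ g, (π₁.mat g * C * (π₂.mat g)ᴴ * A) i j ∂μ := by
  simp only [Matrix.mul_apply (N := A), schurAverage, Matrix.of_apply]
  rw [integral_finsetSum]
  · simp only [integral_mul_const]
  · intro k _
    exact (((continuous_mat_mul_mul_conjTranspose π₁ π₂ C).matrix_elem
      i k).mul continuous_const).integrable_of_hasCompactSupport
        (HasCompactSupport.of_compactSpace _)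

variable [IsTopologicalGroup G]

/-- The substitution `g ↦ h g` produces `π₁(h)` on the left and `π₂(h)*` on the right, and the
latter is cancelled by `π₂(h)`. -/
theorem mat_mul_schurAverage [μ.IsMulLeftInvariant] (h : G) :
    π₁.mat h * schurAverage μ π₁ π₂ C = schurAverage μ π₁ π₂ C * π₂.mat h := by
  ext i j
  rw [mul_schurAverage_apply, schurAverage_mul_apply,
    ← integral_mul_left_eq_self (fun g => (π₁.mat g * C * (π₂.mat g)ᴴ * π₂.mat h) i j) h]
  refine integral_congr_ae (ae_of_all _ fun g => ?_)
  have h1 : (π₂.mat h)ᴴ * π₂.mat h = 1 := by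
    rw [← π₂.mat_inv, ← π₂.mat_mul]; simp [UnitaryIrrep.mat]
  simp only [π₁.mat_mul, π₂.mat_mul, Matrix.conjTranspose_mul, Matrix.mul_assoc, h1, Matrix.mul_one]

/-- The intertwining relation at `g⁻¹`, integrated against `f(g)`. For central `f` both Fourier
matrices are scalars, which forces the average to vanish if the scalars differ. -/
theorem groupFourier_mul_schurAverage [μ.IsMulLeftInvariant] {f : G → ℂ} (hf : Integrable f μ) :
    groupFourier μ f π₁ * schurAverage μ π₁ π₂ C =
      schurAverage μ π₁ π₂ C * groupFourier μ f π₂ := by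
  ext i j
  rw [groupFourier_mul_apply π₁ hf, mul_groupFourier_apply π₂ hf]
  simp only [← UnitaryIrrep.mat_inv, mat_mul_schurAverage]

/-- Two representations on which a central function has different Fourier coefficients have
orthogonal matrix coefficients. -/
theorem inner_eq_zero_of_groupFourier_ne [μ.IsMulLeftInvariant] [μ.IsMulRightInvariant]
    {π₁ π₂ : UnitaryIrrep G}
    {ψ : Lp ℂ 2 μ} (hψ : IsCentral μ ψ)
    (hne : groupFourier μ ψ π₁ π₁.index π₁.index ≠ groupFourier μ ψ π₂ π₂.index π₂.index)
    {f k : Lp ℂ 2 μ} (hf : f ∈ coeffSpace μ π₁) (hk : k ∈ coeffSpace μ π₂) :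
    inner ℂ k f = 0 := by
  have hi : Integrable ψ μ := (Lp.memLp ψ).integrable (by norm_num)
  have hzero : ∀ C, schurAverage μ π₁ π₂ C = 0 := fun C => by
    have h := groupFourier_mul_schurAverage π₁ π₂ C hi
    rw [groupFourier_eq_smul_one_of_isCentral hψ π₁,
      groupFourier_eq_smul_one_of_isCentral hψ π₂, Matrix.smul_mul, Matrix.mul_smul,
      Matrix.one_mul, Matrix.mul_one] at h
    by_contra hC
    exact hne (smul_left_injective ℂ hC h)
  -- For the matrix unit `C = E_{jl}`, the `(i, k)` entry of the average is exactly this integral.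
  have hent : ∀ i j k l, ∫ g, π₁.mat g i j * star (π₂.mat g k l) ∂μ = 0 := fun i j k l => by
    have h := congrFun (congrFun (hzero (Matrix.single j l 1)) i) k
    simpa [schurAverage, Matrix.mul_apply, Matrix.single_apply, Finset.sum_ite_eq, ite_and] using h
  obtain ⟨A, hA⟩ := hf
  obtain ⟨B, hB⟩ := hk
  have hsum : ∀ g, (π₁.mat g * A).trace * star (π₂.mat g * B).trace =
      ∑ i, ∑ j, ∑ k, ∑ l, A j i * star (B l k) * (π₁.mat g i j * star (π₂.mat g k l)) := fun g => by
    simp only [Matrix.trace, Matrix.diag, Matrix.mul_apply, star_sum, star_mul']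
    rw [Finset.sum_mul]
    refine Finset.sum_congr rfl fun i _ => ?_
    rw [Finset.sum_mul]
    refine Finset.sum_congr rfl fun j _ => ?_
    rw [Finset.mul_sum]
    refine Finset.sum_congr rfl fun k _ => ?_
    rw [Finset.mul_sum]
    exact Finset.sum_congr rfl fun l _ => by ring
  have hcont : ∀ i j k l,
      Integrable (fun g => A j i * star (B l k) * (π₁.mat g i j * star (π₂.mat g k l))) μ :=
    fun i j k l => (continuous_const.mul ((π₁.continuous_mat_apply i j).mul
      (continuous_star.comp (π₂.continuous_mat_apply k l)))).integrable_of_hasCompactSupport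
        (HasCompactSupport.of_compactSpace _)
  calc inner ℂ k f = ∫ g, (π₁.mat g * A).trace * star (π₂.mat g * B).trace ∂μ := by
        rw [L2.inner_def]
        refine integral_congr_ae ?_
        filter_upwards [hA, hB] with g h1 h2
        rw [h1, h2]; rfl
    _ = ∑ i, ∑ j, ∑ k, ∑ l,
          ∫ g, A j i * star (B l k) * (π₁.mat g i j * star (π₂.mat g k l)) ∂μ := by
        simp only [hsum]
        rw [integral_finsetSum _ fun i _ => integrable_finsetSum _ fun j _ =>
          integrable_finsetSum _ fun k _ => integrable_finsetSum _ fun l _ => hcont i j k l]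
        refine Finset.sum_congr rfl fun i _ => ?_
        rw [integral_finsetSum _ fun j _ =>
          integrable_finsetSum _ fun k _ => integrable_finsetSum _ fun l _ => hcont i j k l]
        refine Finset.sum_congr rfl fun j _ => ?_
        rw [integral_finsetSum _ fun k _ => integrable_finsetSum _ fun l _ => hcont i j k l]
        refine Finset.sum_congr rfl fun k _ => ?_
        rw [integral_finsetSum _ fun l _ => hcont i j k l]
    _ = 0 := by simp only [integral_const_mul, hent, mul_zero, Finset.sum_const_zero]

end Orthogonality

/-! ### The group transform as a pairing with translates -/

section Pairing

variable {G : Type*} [Group G] [TopologicalSpace G] [IsTopologicalGroup G]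
  [MeasurableSpace G] [BorelSpace G] {μ : Measure G} [μ.IsMulRightInvariant]

/-- Right translation `f ↦ f(· g)` on `L²(G)`. -/
def rightTranslate (μ : Measure G) [μ.IsMulRightInvariant] (g : G) : Lp ℂ 2 μ →ₗᵢ[ℂ] Lp ℂ 2 μ :=
  Lp.compMeasurePreservingₗᵢ ℂ (· * g) (measurePreserving_mul_right μ g)

theorem coeFn_rightTranslate (g : G) (f : Lp ℂ 2 μ) :
    rightTranslate μ g f =ᵐ[μ] fun h => f (h * g) :=
  Lp.coeFn_compMeasurePreserving f (measurePreserving_mul_right μ g)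

/-- The wavelet transform on the group, `(ρ, g) ↦ ∫ f(h g) conj(ψ_ρ(h)) dμ(h)`. -/
def groupTransform (μ : Measure G) [μ.IsMulRightInvariant] (ψ : ℝ → Lp ℂ 2 μ) (f : Lp ℂ 2 μ)
    (q : ℝ × G) : ℂ :=
  inner ℂ (ψ q.1) (rightTranslate μ q.2 f)

theorem groupTransform_add (ψ : ℝ → Lp ℂ 2 μ) (f k : Lp ℂ 2 μ) :
    groupTransform μ ψ (f + k) = groupTransform μ ψ f + groupTransform μ ψ k := by
  ext q; simp [groupTransform, inner_add_right]

theorem groupTransform_zero (ψ : ℝ → Lp ℂ 2 μ) : groupTransform μ ψ 0 = 0 := by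
  ext q; simp [groupTransform]

/-- On `H_π` the transform with a central wavelet is multiplication by a scalar. -/
theorem inner_rightTranslate_of_isCentral [μ.IsMulLeftInvariant] [IsFiniteMeasure μ]
    {ψ f : Lp ℂ 2 μ} (hψ : IsCentral μ ψ)
    {π : UnitaryIrrep G} {A : Matrix (Fin π.dim) (Fin π.dim) ℂ}
    (hf : f =ᵐ[μ] fun g => (π.mat g * A).trace) (g : G) :
    inner ℂ ψ (rightTranslate μ g f) =
      star (groupFourier μ ψ π π.index π.index) * (π.mat g * A).trace := by
  have hi : Integrable (fun g => star (ψ g)) μ :=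
    (LinearIsometryEquiv.integrable_comp_iff Complex.conjLIE).2
      ((Lp.memLp ψ).integrable (by norm_num))
  set B := π.mat g * A with hB
  calc inner ℂ ψ (rightTranslate μ g f) = ∫ h, star (ψ h) * (π.mat h * B).trace ∂μ := by
        rw [L2.inner_def]
        refine integral_congr_ae ?_
        filter_upwards [coeFn_rightTranslate g f,
          (measurePreserving_mul_right μ g).quasiMeasurePreserving.ae_eq_comp hf] with h h1 h2
        rw [h1, RCLike.inner_apply, mul_comm]
        simp only [Function.comp] at h2
        rw [h2, π.mat_mul, hB, Matrix.mul_assoc]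
        rfl
    _ = ∑ i, ∑ j, (groupFourier μ ψ π)ᴴ i j * B j i := by
        simp only [Matrix.trace, Matrix.diag, Matrix.mul_apply, Finset.mul_sum, ← mul_assoc]
        rw [integral_finsetSum _ fun i _ => integrable_finsetSum _ fun j _ =>
          (π.integrable_mul_mat hi i j).mul_const _]
        refine Finset.sum_congr rfl fun i _ => ?_
        rw [integral_finsetSum _ fun j _ => (π.integrable_mul_mat hi i j).mul_const _]
        simp only [integral_mul_const, integral_star_mul_mat]
    _ = star (groupFourier μ ψ π π.index π.index) * B.trace := by
        rw [groupFourier_eq_smul_one_of_isCentral hψ π]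
        simp [Matrix.one_apply, Matrix.trace, Finset.mul_sum, apply_ite (starRingEnd ℂ)]

/-- Joint measurability of pairings of a measurable with a continuous family. -/
theorem aestronglyMeasurable_inner_prod {Y Z : Type*} [MeasurableSpace Y] [TopologicalSpace Z]
    [MeasurableSpace Z] [OpensMeasurableSpace Z] {H : Type*} [NormedAddCommGroup H]
    [InnerProductSpace ℂ H] [SecondCountableTopology H] {ν : Measure Y} {m : Measure Z} [SFinite m]
    {u : Y → H} (hu : AEStronglyMeasurable u ν) {v : Z → H} (hv : Continuous v) :
    AEStronglyMeasurable (fun q : Y × Z => (inner ℂ (u q.1) (v q.2) : ℂ)) (ν.prod m) :=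
  hu.comp_fst.inner (hv.stronglyMeasurable.aestronglyMeasurable.comp_snd)

theorem continuous_rightTranslate [CompactSpace G] [μ.IsHaarMeasure] (f : Lp ℂ 2 μ) :
    Continuous fun g => rightTranslate μ g f := by
  have h : Continuous fun g : G => (⟨(· * g), continuous_mul_const g⟩ : C(G, G)) :=
    ContinuousMap.continuous_of_continuous_uncurry _ (continuous_snd.mul continuous_fst)
  exact (continuous_const (y := f)).compMeasurePreservingLp h
    (fun g => measurePreserving_mul_right μ g) (by norm_num)

end Pairing

/-! ### The scale measure and the transform on one `H_π` -/

section Scale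

variable {α : ℝ → ℝ}

instance : SFinite (scaleMeasure α) := by
  have : SigmaFinite (scaleMeasure α) :=
    SigmaFinite.withDensity_of_ne_top' fun _ => ENNReal.ofReal_ne_top
  infer_instance

theorem ae_scaleMeasure_pos : ∀ᵐ ρ ∂scaleMeasure α, 0 < ρ :=
  (withDensity_absolutelyContinuous _ _).ae_le (ae_restrict_mem measurableSet_Ioi)

end Scale

section CoeffSpace

variable {G : Type*} [Group G] [TopologicalSpace G] [IsTopologicalGroup G] [MeasurableSpace G]
  [BorelSpace G] {μ : Measure G} [μ.IsMulLeftInvariant] [μ.IsMulRightInvariant] [IsFiniteMeasure μ]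
  {α : ℝ → ℝ} {ψ : ℝ → Lp ℂ 2 μ}

/-- Exhibits the transform as a pure tensor in `(ρ, g)`, so that integrals over the product factor.
-/
theorem groupTransform_ae_eq_of_mem_coeffSpace
    (hψ_central : ∀ ρ : ℝ, 0 < ρ → IsCentral μ (ψ ρ)) {π : UnitaryIrrep G}
    {f : Lp ℂ 2 μ} (hf : f ∈ coeffSpace μ π) :
    groupTransform μ ψ f =ᵐ[(scaleMeasure α).prod μ]
      fun q => star (groupFourier μ (ψ q.1) π π.index π.index) * f q.2 := by
  obtain ⟨A, hA⟩ := hf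
  filter_upwards [Measure.quasiMeasurePreserving_fst.ae (ae_scaleMeasure_pos (α := α)),
    Measure.quasiMeasurePreserving_snd.ae_eq_comp hA] with q hq hq2
  simp only [Function.comp] at hq2
  rw [groupTransform, inner_rightTranslate_of_isCentral (hψ_central _ hq) hA, hq2]

end CoeffSpace

/-! ### The isometry on `L²₀(G)` -/

section Isometry

variable {G : Type*} [Group G] [TopologicalSpace G] [IsTopologicalGroup G] [CompactSpace G]
  [SecondCountableTopology G] [MeasurableSpace G] [BorelSpace G] {μ : Measure G}
  [μ.IsHaarMeasure] [μ.IsMulRightInvariant] {Gp : Set (UnitaryDual G)}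
  {p : ℝ → Lp ℂ 1 μ} {α : ℝ → ℝ} {ψ : ℝ → Lp ℂ 2 μ}

theorem aestronglyMeasurable_groupTransform
    (hψ : AEStronglyMeasurable ψ (volume.restrict (Ioi 0))) (f : Lp ℂ 2 μ) :
    AEStronglyMeasurable (groupTransform μ ψ f) ((scaleMeasure α).prod μ) :=
  -- Finiteness of the exponent enters the separability of `L²`, required for strong measurability
  -- of the continuous factor.
  have : Fact ((2 : ENNReal) ≠ ⊤) := ⟨ENNReal.ofNat_ne_top⟩
  aestronglyMeasurable_inner_prod (hψ.mono_ac (withDensity_absolutelyContinuous _ _))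
    (continuous_rightTranslate f)

variable [IsProbabilityMeasure μ] [μ.IsInvInvariant]

/-- Admissibility of a central wavelet family says that on `Ĝ₊` the Fourier coefficients have norm
`1` in `L²(ℝ₊, α(ρ) dρ)`. -/
theorem integrable_and_integral_norm_sq_groupFourier (hp : IsDiffusiveApproxIdentity μ Gp p)
    (hα : AEMeasurable α (volume.restrict (Ioi 0))) (hα_pos : ∀ ρ : ℝ, 0 < ρ → 0 < α ρ)
    (hψ : IsDiffusiveWaveletFamily μ Gp p α ψ) (hψ_central : ∀ ρ : ℝ, 0 < ρ → IsCentral μ (ψ ρ))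
    {π : UnitaryIrrep G} (hπ : π.cls ∈ Gp) :
    Integrable (fun ρ => ‖groupFourier μ (ψ ρ) π π.index π.index‖ ^ 2) (scaleMeasure α) ∧
      ∫ ρ, ‖groupFourier μ (ψ ρ) π π.index π.index‖ ^ 2 ∂scaleMeasure α = 1 := by
  set c : ℝ → ℂ := fun ρ => groupFourier μ (ψ ρ) π π.index π.index with hc
  have hconv : ∀ ρ, 0 < ρ → groupFourier μ (groupConv μ (groupCheck (ψ ρ)) (ψ ρ)) π π.index π.index
      * (α ρ : ℂ) = ((‖c ρ‖ ^ 2 * α ρ : ℝ) : ℂ) := fun ρ hρ => by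
    rw [groupFourier_groupConv_groupCheck ((Lp.memLp (ψ ρ)).integrable (by norm_num)),
      groupFourier_eq_smul_one_of_isCentral (hψ_central ρ hρ)]
    have h1 : c ρ * star (c ρ) = ((‖c ρ‖ ^ 2 : ℝ) : ℂ) := by
      rw [Complex.star_def, Complex.mul_conj', Complex.ofReal_pow]
    rw [Complex.ofReal_mul, ← h1, Matrix.conjTranspose_smul, Matrix.conjTranspose_one,
      Matrix.smul_mul, Matrix.one_mul, Matrix.smul_apply, Matrix.smul_apply, Matrix.one_apply_eq]
    simp [hc]
  have hint : ∀ t : ℝ, 0 < t → IntegrableOn (fun ρ => ‖c ρ‖ ^ 2 * α ρ) (Ioi t) := fun t ht => by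
    have h := (hψ.integrableOn t ht π π.index π.index).congr_fun
      (fun ρ hρ => hconv ρ (ht.trans hρ)) measurableSet_Ioi
    exact h.re
  have hval : ∀ t : ℝ, 0 < t →
      ∫ ρ in Ioi t, ‖c ρ‖ ^ 2 * α ρ = (groupFourier μ (p t) π π.index π.index).re := fun t ht => by
    have h := hψ.admissible t ht π π.index π.index
    rw [if_pos hπ, setIntegral_congr_fun measurableSet_Ioi fun ρ hρ => hconv ρ (ht.trans hρ),
      integral_complex_ofReal] at h
    rw [← h, Complex.ofReal_re]
  have hlim : Tendsto (fun t : ℝ => ∫ ρ in Ioi t, ‖c ρ‖ ^ 2 * α ρ) (𝓝[>] 0) (𝓝 1) := by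
    have h1 : Tendsto (fun t : ℝ => (groupFourier μ (p t) π π.index π.index).re) (𝓝[>] 0)
        (𝓝 1) := by
      have h2 : Continuous fun M : Matrix (Fin π.dim) (Fin π.dim) ℂ => (M π.index π.index).re :=
        Complex.continuous_re.comp (continuous_id.matrix_elem _ _)
      have h3 := (h2.tendsto 1).comp (hp.tendsto_zero π)
      simp only [Matrix.one_apply_eq, Complex.one_re] at h3
      exact h3
    refine h1.congr' ?_
    filter_upwards [self_mem_nhdsWithin] with t ht using (hval t ht).symm
  have hseq : Tendsto (fun n : ℕ => 1 / ((n : ℝ) + 1)) atTop (𝓝[>] 0) :=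
    tendsto_nhdsWithin_iff.2 ⟨tendsto_one_div_add_atTop_nhds_zero_nat,
      Eventually.of_forall fun n => mem_Ioi.2 Nat.one_div_pos_of_nat⟩
  -- The integrand is nonnegative, so convergence of its integrals over the exhausting half-lines
  -- `(1/(n+1), ∞)` yields both integrability on `(0, ∞)` and the value `1`.
  have hcover : AECover (volume.restrict (Ioi (0 : ℝ))) atTop
      fun n : ℕ => Ioi (1 / ((n : ℝ) + 1)) :=
    aecover_Ioi_of_Ioi tendsto_one_div_add_atTop_nhds_zero_nat
  have hres : ∀ n : ℕ, (volume.restrict (Ioi (0 : ℝ))).restrict (Ioi (1 / ((n : ℝ) + 1))) =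
      volume.restrict (Ioi (1 / ((n : ℝ) + 1))) := fun n => by
    rw [Measure.restrict_restrict measurableSet_Ioi, Ioi_inter_Ioi,
      sup_of_le_left Nat.one_div_pos_of_nat.le]
  have hfi : ∀ n : ℕ, IntegrableOn (fun ρ => ‖c ρ‖ ^ 2 * α ρ) (Ioi (1 / ((n : ℝ) + 1)))
      (volume.restrict (Ioi 0)) := fun n => by
    rw [IntegrableOn, hres]
    exact hint _ Nat.one_div_pos_of_nat
  have hnn : ∀ᵐ ρ ∂volume.restrict (Ioi (0 : ℝ)), 0 ≤ ‖c ρ‖ ^ 2 * α ρ := by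
    filter_upwards [ae_restrict_mem measurableSet_Ioi] with ρ hρ
    exact mul_nonneg (sq_nonneg _) (hα_pos ρ hρ).le
  have htend : Tendsto (fun n : ℕ => ∫ ρ in Ioi (1 / ((n : ℝ) + 1)), ‖c ρ‖ ^ 2 * α ρ
      ∂volume.restrict (Ioi 0)) atTop (𝓝 1) := by
    simp only [hres]
    exact hlim.comp hseq
  have hI := hcover.integrable_of_integral_tendsto_of_nonneg_ae 1 hfi hnn htend
  have hV := hcover.integral_eq_of_tendsto_of_nonneg_ae 1 hnn hfi htend
  have hcongr : (fun ρ => ‖c ρ‖ ^ 2 * α ρ) =ᵐ[volume.restrict (Ioi 0)]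
      fun ρ => (ENNReal.ofReal (α ρ)).toReal • ‖c ρ‖ ^ 2 := by
    filter_upwards [ae_restrict_mem measurableSet_Ioi] with ρ hρ
    rw [ENNReal.toReal_ofReal (hα_pos ρ hρ).le, smul_eq_mul, mul_comm]
  refine ⟨(integrable_withDensity_iff_integrable_smul₀' hα.ennreal_ofReal
    (ae_of_all _ fun _ => ENNReal.ofReal_lt_top)).2 (hI.congr hcongr), ?_⟩
  rw [scaleMeasure, integral_withDensity_eq_integral_toReal_smul₀ hα.ennreal_ofReal
    (ae_of_all _ fun _ => ENNReal.ofReal_lt_top), ← integral_congr_ae hcongr, hV]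

/-- The transform is isometric on the algebraic sum of the spaces `H_π`, `[π] ∈ Ĝ₊`. -/
theorem groupTransform_isometric_of_mem_iSup (hp : IsDiffusiveApproxIdentity μ Gp p)
    (hα : AEMeasurable α (volume.restrict (Ioi 0))) (hα_pos : ∀ ρ : ℝ, 0 < ρ → 0 < α ρ)
    (hψ : IsDiffusiveWaveletFamily μ Gp p α ψ) (hψ_central : ∀ ρ : ℝ, 0 < ρ → IsCentral μ (ψ ρ))
    {f : Lp ℂ 2 μ} (hf : f ∈ ⨆ π : {π : UnitaryIrrep G // π.cls ∈ Gp}, coeffSpace μ π.1) :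
    eLpNorm (groupTransform μ ψ f) 2 ((scaleMeasure α).prod μ) = ‖f‖ₑ := by
  have hmeas := fun k : Lp ℂ 2 μ =>
    aestronglyMeasurable_groupTransform (α := α) hψ.aestronglyMeasurable k
  have hnorm := fun (π : {π : UnitaryIrrep G // π.cls ∈ Gp}) =>
    integrable_and_integral_norm_sq_groupFourier hp hα hα_pos hψ hψ_central π.2
  have hmem : ∀ k ∈ ⨆ π : {π : UnitaryIrrep G // π.cls ∈ Gp}, coeffSpace μ π.1,
      MemLp (groupTransform μ ψ k) 2 ((scaleMeasure α).prod μ) := fun k hk => by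
    refine Submodule.iSup_induction _
      (motive := fun k => MemLp (groupTransform μ ψ k) 2 ((scaleMeasure α).prod μ)) hk
      (fun π k hk => ?_) ?_ fun k l hk hl => ?_
    · rw [memLp_two_iff_integrable_sq_norm (hmeas k)]
      refine ((hnorm π).1.mul_prod
        ((memLp_two_iff_integrable_sq_norm (Lp.aestronglyMeasurable k)).1 (Lp.memLp k))).congr ?_
      filter_upwards [groupTransform_ae_eq_of_mem_coeffSpace (α := α) hψ_central hk] with q hq
      rw [hq, norm_mul, norm_star, mul_pow]
    · rw [groupTransform_zero]; exact MemLp.zero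
    · rw [groupTransform_add]; exact hk.add hl
  have hbase : ∀ π σ : {π : UnitaryIrrep G // π.cls ∈ Gp}, ∀ k ∈ coeffSpace μ π.1,
      ∀ l ∈ coeffSpace μ σ.1,
      ∫ q, inner ℂ (groupTransform μ ψ k q) (groupTransform μ ψ l q) ∂(scaleMeasure α).prod μ =
        inner ℂ k l := fun π σ k hk l hl => by
    have h1 : ∫ q, inner ℂ (groupTransform μ ψ k q) (groupTransform μ ψ l q)
        ∂(scaleMeasure α).prod μ =
        (∫ ρ, groupFourier μ (ψ ρ) π.1 π.1.index π.1.index *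
          star (groupFourier μ (ψ ρ) σ.1 σ.1.index σ.1.index) ∂scaleMeasure α) * inner ℂ k l := by
      rw [L2.inner_def, ← integral_prod_mul]
      refine integral_congr_ae ?_
      filter_upwards [groupTransform_ae_eq_of_mem_coeffSpace (α := α) hψ_central hk,
        groupTransform_ae_eq_of_mem_coeffSpace (α := α) hψ_central hl] with q hq1 hq2
      rw [hq1, hq2]
      simp only [RCLike.inner_apply, map_mul, Complex.star_def, Complex.conj_conj]
      ring
    -- If the scalars agree at every scale, the scale integral is the norm square `1`, whether or
    -- not `π` and `σ` are equivalent. Otherwise one separating `ψ_ρ` makes `⟨k, l⟩` vanish.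
    by_cases hπσ : ∀ ρ : ℝ, 0 < ρ → groupFourier μ (ψ ρ) π.1 π.1.index π.1.index =
        groupFourier μ (ψ ρ) σ.1 σ.1.index σ.1.index
    · have h2 : ∫ ρ, groupFourier μ (ψ ρ) π.1 π.1.index π.1.index *
          star (groupFourier μ (ψ ρ) σ.1 σ.1.index σ.1.index) ∂scaleMeasure α =
          ∫ ρ, ((‖groupFourier μ (ψ ρ) π.1 π.1.index π.1.index‖ ^ 2 : ℝ) : ℂ) ∂scaleMeasure α := by
        refine integral_congr_ae ?_
        filter_upwards [ae_scaleMeasure_pos] with ρ hρ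
        rw [← hπσ ρ hρ, Complex.star_def, Complex.mul_conj', Complex.ofReal_pow]
      rw [h1, h2, integral_complex_ofReal, (hnorm π).2, Complex.ofReal_one, one_mul]
    · push Not at hπσ
      obtain ⟨ρ, hρ, hne⟩ := hπσ
      rw [h1, inner_eq_zero_of_groupFourier_ne (hψ_central ρ hρ) hne.symm hl hk, mul_zero]
  have hint : ∀ k ∈ ⨆ π : {π : UnitaryIrrep G // π.cls ∈ Gp}, coeffSpace μ π.1,
      ∀ l ∈ ⨆ π : {π : UnitaryIrrep G // π.cls ∈ Gp}, coeffSpace μ π.1,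
      Integrable (fun q => (inner ℂ (groupTransform μ ψ k q) (groupTransform μ ψ l q) : ℂ))
        ((scaleMeasure α).prod μ) := fun k hk l hl => by
    simp only [RCLike.inner_apply]
    exact (hmem l hl).integrable_mul (hmem k hk).star
  have hinner : ∀ k ∈ ⨆ π : {π : UnitaryIrrep G // π.cls ∈ Gp}, coeffSpace μ π.1,
      ∀ l ∈ ⨆ π : {π : UnitaryIrrep G // π.cls ∈ Gp}, coeffSpace μ π.1,
      ∫ q, inner ℂ (groupTransform μ ψ k q) (groupTransform μ ψ l q) ∂(scaleMeasure α).prod μ =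
        inner ℂ k l := fun k hk l hl => by
    induction hk using Submodule.iSup_induction' with
    | mem π k hk =>
      induction hl using Submodule.iSup_induction' with
      | mem σ l hl => exact hbase π σ k hk l hl
      | zero => simp [groupTransform_zero]
      | add l l' hl hl' h h' =>
        have hk' := Submodule.mem_iSup_of_mem (p := fun π : {π : UnitaryIrrep G // π.cls ∈ Gp} =>
          coeffSpace μ π.1) π hk
        simp only [groupTransform_add, Pi.add_apply, inner_add_right]
        rw [integral_add (hint k hk' l hl) (hint k hk' l' hl'), h, h']
    | zero => simp [groupTransform_zero]
    | add k k' hk hk' h h' =>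
      simp only [groupTransform_add, Pi.add_apply, inner_add_left]
      rw [integral_add (hint k hk l hl) (hint k' hk' l hl), h, h']
  have h1 : (inner ℂ ((hmem f hf).toLp _) ((hmem f hf).toLp _) : ℂ) = inner ℂ f f := by
    rw [← hinner f hf f hf, L2.inner_def]
    refine integral_congr_ae ?_
    filter_upwards [(hmem f hf).coeFn_toLp] with q hq
    rw [hq]
  rw [inner_self_eq_norm_sq_to_K, inner_self_eq_norm_sq_to_K] at h1
  have h2 : ‖(hmem f hf).toLp _‖ = ‖f‖ := by
    have h3 : ‖(hmem f hf).toLp _‖ ^ 2 = ‖f‖ ^ 2 := by exact_mod_cast h1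
    exact (sq_eq_sq₀ (norm_nonneg _) (norm_nonneg _)).1 h3
  rw [← Lp.enorm_toLp (hf := hmem f hf), ← ofReal_norm, h2, ofReal_norm]

/-- The transform is isometric on `L²₀(G)`. -/
theorem groupTransform_isometric (hp : IsDiffusiveApproxIdentity μ Gp p)
    (hα : AEMeasurable α (volume.restrict (Ioi 0))) (hα_pos : ∀ ρ : ℝ, 0 < ρ → 0 < α ρ)
    (hψ : IsDiffusiveWaveletFamily μ Gp p α ψ) (hψ_central : ∀ ρ : ℝ, 0 < ρ → IsCentral μ (ψ ρ))
    {f : Lp ℂ 2 μ} (hf : f ∈ L2ZeroGroup μ Gp) :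
    eLpNorm (groupTransform μ ψ f) 2 ((scaleMeasure α).prod μ) = ‖f‖ₑ := by
  have hmeas := fun k : Lp ℂ 2 μ =>
    aestronglyMeasurable_groupTransform (α := α) hψ.aestronglyMeasurable k
  have hiso := fun (k : Lp ℂ 2 μ) hk =>
    groupTransform_isometric_of_mem_iSup (f := k) hp hα hα_pos hψ hψ_central hk
  have happrox : ∀ k ∈ L2ZeroGroup μ Gp, ∃ u : ℕ → Lp ℂ 2 μ,
      (∀ n, u n ∈ ⨆ π : {π : UnitaryIrrep G // π.cls ∈ Gp}, coeffSpace μ π.1) ∧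
        Tendsto u atTop (𝓝 k) := fun k hk => mem_closure_iff_seq_limit.1 hk
  have hle : ∀ k ∈ L2ZeroGroup μ Gp,
      eLpNorm (groupTransform μ ψ k) 2 ((scaleMeasure α).prod μ) ≤ ‖k‖ₑ := fun k hk => by
    obtain ⟨u, hu, hlim⟩ := happrox k hk
    -- Fatou: at each fixed `(ρ, g)` the transform is continuous in `f`, so `L²` convergence of `u`
    -- gives pointwise convergence of the transforms.
    refine (Lp.eLpNorm_lim_le_liminf_eLpNorm (fun n => hmeas (u n)) _
      (ae_of_all _ fun q => ?_)).trans_eq ?_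
    · exact tendsto_const_nhds.inner (((rightTranslate μ q.2).continuous.tendsto k).comp hlim)
    · simp only [hiso _ (hu _)]
      exact hlim.enorm.liminf_eq
  obtain ⟨u, hu, hlim⟩ := happrox f hf
  refine (hle f hf).antisymm ?_
  -- The reverse inequality: write `u n = f + (u n - f)` and apply the upper bound `hle` to the
  -- difference, which tends to `0`.
  have hbound : ∀ n, ‖u n‖ₑ ≤
      eLpNorm (groupTransform μ ψ f) 2 ((scaleMeasure α).prod μ) + ‖u n - f‖ₑ := fun n => by
    have hsub : u n - f ∈ L2ZeroGroup μ Gp :=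
      Submodule.sub_mem _ (Submodule.le_topologicalClosure _ (hu n)) hf
    calc ‖u n‖ₑ = eLpNorm (groupTransform μ ψ (f + (u n - f))) 2 ((scaleMeasure α).prod μ) := by
          rw [add_sub_cancel, hiso _ (hu n)]
      _ ≤ eLpNorm (groupTransform μ ψ f) 2 ((scaleMeasure α).prod μ) +
          eLpNorm (groupTransform μ ψ (u n - f)) 2 ((scaleMeasure α).prod μ) := by
          rw [groupTransform_add]
          exact eLpNorm_add_le (hmeas _) (hmeas _) one_le_two
      _ ≤ _ := by gcongr; exact hle _ hsub
  have hlim' : Tendsto (fun n => ‖u n - f‖ₑ) atTop (𝓝 0) := by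
    simpa using (hlim.sub_const f).enorm
  simpa using le_of_tendsto_of_tendsto' hlim.enorm (tendsto_const_nhds.add hlim') hbound

end Isometry

/-! ### Transfer to the homogeneous space -/

section HomogeneousSpace

variable {G : Type*} [Group G] [TopologicalSpace G] [MeasurableSpace G] [BorelSpace G]
  {μ : Measure G} {X : Type*} [TopologicalSpace X] [MeasurableSpace X] [BorelSpace X]
  [MulAction G X] [ContinuousSMul G X] {x₀ : X}

theorem coeFn_orbitLift (φ : Lp ℂ 2 (orbitMeasure μ x₀)) :
    orbitLift μ x₀ φ =ᵐ[μ] fun g => φ (g • x₀) :=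
  Lp.coeFn_compMeasurePreserving φ (measurePreserving_orbit μ x₀)

variable [IsTopologicalGroup G] [μ.IsMulRightInvariant] [MulAction.IsPretransitive G X]

variable (μ x₀) in
/-- On a homogeneous space, all orbit maps have the same image measure. -/
theorem measurePreserving_smul_orbitMeasure (x : X) :
    MeasurePreserving (fun g : G => g • x) μ (orbitMeasure μ x₀) := by
  obtain ⟨k, rfl⟩ := MulAction.exists_smul_eq G x₀ x
  simpa [Function.comp_def, mul_smul] using
    (measurePreserving_orbit μ x₀).comp (measurePreserving_mul_right μ k)

variable (μ x₀) in
/-- The lift `φ ↦ φ(· • x)` from `L²(X)` to `L²(G)` at an arbitrary base point `x`. -/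
def orbitLiftAt (x : X) : Lp ℂ 2 (orbitMeasure μ x₀) →ₗᵢ[ℂ] Lp ℂ 2 μ :=
  Lp.compMeasurePreservingₗᵢ ℂ (fun g : G => g • x) (measurePreserving_smul_orbitMeasure μ x₀ x)

theorem coeFn_orbitLiftAt (x : X) (φ : Lp ℂ 2 (orbitMeasure μ x₀)) :
    orbitLiftAt μ x₀ x φ =ᵐ[μ] fun g => φ (g • x) :=
  Lp.coeFn_compMeasurePreserving φ (measurePreserving_smul_orbitMeasure μ x₀ x)

theorem orbitLiftAt_smul (g : G) (φ : Lp ℂ 2 (orbitMeasure μ x₀)) :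
    orbitLiftAt μ x₀ (g • x₀) φ = rightTranslate μ g (orbitLift μ x₀ φ) := by
  apply Lp.ext
  filter_upwards [coeFn_orbitLiftAt (g • x₀) φ, coeFn_rightTranslate g (orbitLift μ x₀ φ),
    (measurePreserving_mul_right μ g).quasiMeasurePreserving.ae_eq_comp (coeFn_orbitLift φ)]
    with h h1 h2 h3
  simp only [Function.comp] at h3
  rw [h1, h2, h3, mul_smul]

/-- Valid at every `x`, not just almost every one, because every orbit map carries `μ` to `dx`.
Linearity and joint measurability of the transform are read off from this pairing. -/
theorem zonalTransform_eq_inner (ψ : ℝ → Lp ℂ 2 μ) (φ : Lp ℂ 2 (orbitMeasure μ x₀)) (ρ : ℝ)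
    (x : X) : zonalTransform μ ψ φ ρ x = inner ℂ (ψ ρ) (orbitLiftAt μ x₀ x φ) := by
  rw [zonalTransform, L2.inner_def]
  refine integral_congr_ae ?_
  filter_upwards [coeFn_orbitLiftAt x φ] with h hh
  rw [hh]; rfl

theorem zonalTransform_smul_basepoint (ψ : ℝ → Lp ℂ 2 μ) (φ : Lp ℂ 2 (orbitMeasure μ x₀)) (ρ : ℝ)
    (g : G) : zonalTransform μ ψ φ ρ (g • x₀) = groupTransform μ ψ (orbitLift μ x₀ φ) (ρ, g) := by
  rw [zonalTransform_eq_inner, orbitLiftAt_smul, groupTransform]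

theorem integrable_zonalTransform (ψ : Lp ℂ 2 μ) (φ : Lp ℂ 2 (orbitMeasure μ x₀)) (x : X) :
    Integrable (fun h : G => φ (h • x) * star (ψ h)) μ :=
  ((Lp.memLp φ).comp_measurePreserving
    (measurePreserving_smul_orbitMeasure μ x₀ x)).integrable_mul (Lp.memLp ψ).star

variable [CompactSpace G] [T2Space X] [μ.IsHaarMeasure]

/-- Continuity in `x` with values in `L²(G)` supplies joint measurability on `ℝ₊ × X` without any
countability of `X`. -/
theorem continuous_orbitLiftAt (φ : Lp ℂ 2 (orbitMeasure μ x₀)) :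
    Continuous fun x => orbitLiftAt μ x₀ x φ := by
  have : IsFiniteMeasure (orbitMeasure μ x₀) := by unfold orbitMeasure; infer_instance
  have h : Continuous fun x : X =>
      (⟨(· • x), continuous_id.smul continuous_const⟩ : C(G, X)) :=
    ContinuousMap.continuous_of_continuous_uncurry _ (continuous_snd.smul continuous_fst)
  exact (continuous_const (y := φ)).compMeasurePreservingLp h
    (fun x => measurePreserving_smul_orbitMeasure μ x₀ x) (by norm_num)

theorem aestronglyMeasurable_zonalTransform [SecondCountableTopology G] {α : ℝ → ℝ}
    {ψ : ℝ → Lp ℂ 2 μ} (hψ : AEStronglyMeasurable ψ (volume.restrict (Ioi 0)))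
    (φ : Lp ℂ 2 (orbitMeasure μ x₀)) :
    AEStronglyMeasurable (fun q : ℝ × X => zonalTransform μ ψ φ q.1 q.2)
      ((scaleMeasure α).prod (orbitMeasure μ x₀)) := by
  have : Fact ((2 : ENNReal) ≠ ⊤) := ⟨ENNReal.ofNat_ne_top⟩
  have : IsFiniteMeasure (orbitMeasure μ x₀) := by unfold orbitMeasure; infer_instance
  simp only [zonalTransform_eq_inner]
  exact aestronglyMeasurable_inner_prod (hψ.mono_ac (withDensity_absolutelyContinuous _ _))
    (continuous_orbitLiftAt φ)

/-- The zonal wavelet transform is isometric on `L²₀(X)`. -/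
theorem zonalTransform_isometric [SecondCountableTopology G] [IsProbabilityMeasure μ]
    [μ.IsInvInvariant] {Gp : Set (UnitaryDual G)} {p : ℝ → Lp ℂ 1 μ}
    (hp : IsDiffusiveApproxIdentity μ Gp p) {α : ℝ → ℝ}
    (hα : AEMeasurable α (volume.restrict (Ioi 0))) (hα_pos : ∀ ρ : ℝ, 0 < ρ → 0 < α ρ)
    {ψ : ℝ → Lp ℂ 2 μ} (hψ : IsDiffusiveWaveletFamily μ Gp p α ψ)
    (hψ_central : ∀ ρ : ℝ, 0 < ρ → IsCentral μ (ψ ρ))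
    {φ : Lp ℂ 2 (orbitMeasure μ x₀)} (hφ : φ ∈ L2ZeroSpace μ Gp x₀) :
    eLpNorm (fun q : ℝ × X => zonalTransform μ ψ φ q.1 q.2) 2
      ((scaleMeasure α).prod (orbitMeasure μ x₀)) = ‖φ‖ₑ := by
  have : IsFiniteMeasure (orbitMeasure μ x₀) := by unfold orbitMeasure; infer_instance
  have hmp : MeasurePreserving (Prod.map id fun g : G => g • x₀) ((scaleMeasure α).prod μ)
      ((scaleMeasure α).prod (orbitMeasure μ x₀)) :=
    (MeasurePreserving.id _).prod (measurePreserving_orbit μ x₀)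
  have hcomp : (fun q : ℝ × X => zonalTransform μ ψ φ q.1 q.2) ∘ Prod.map id (fun g : G => g • x₀)
      = groupTransform μ ψ (orbitLift μ x₀ φ) := by
    ext q
    exact zonalTransform_smul_basepoint ψ φ q.1 q.2
  -- The norm over `ℝ₊ × X` is pulled back along `(ρ, g) ↦ (ρ, g • x₀)`, where the isometry on the
  -- group applies to the lift.
  rw [← eLpNorm_comp_measurePreserving
    (aestronglyMeasurable_zonalTransform hψ.aestronglyMeasurable φ) hmp, hcomp,
    groupTransform_isometric hp hα hα_pos hψ hψ_central hφ, ← ofReal_norm, ← ofReal_norm]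
  exact congrArg _ (Lp.norm_compMeasurePreserving φ (measurePreserving_orbit μ x₀))

end HomogeneousSpace

end

/-! ### The zonal wavelet transform as a linear isometry -/

theorem mainTheorem4
    {E : Type*} [NormedAddCommGroup E] [NormedSpace ℝ E] [FiniteDimensional ℝ E]
    {G : Type*} [Group G] [TopologicalSpace G] [ChartedSpace E G] [LieGroup 𝓘(ℝ, E) ∞ G]
    [CompactSpace G] [T2Space G] [MeasurableSpace G] [BorelSpace G]
    (μ : Measure G) [μ.IsHaarMeasure] [IsProbabilityMeasure μ]
    {X : Type*} [TopologicalSpace X] [T2Space X] [MeasurableSpace X] [BorelSpace X]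
    [MulAction G X] [ContinuousSMul G X] [MulAction.IsPretransitive G X] (x₀ : X)
    (Gp : Set (UnitaryDual G)) (p : ℝ → Lp ℂ 1 μ) (hp : IsDiffusiveApproxIdentity μ Gp p)
    (α : ℝ → ℝ) (hα : AEMeasurable α (volume.restrict (Ioi 0))) (hα_pos : ∀ ρ : ℝ, 0 < ρ → 0 < α ρ)
    (ψ : ℝ → Lp ℂ 2 μ) (hψ : IsDiffusiveWaveletFamily μ Gp p α ψ)
    (hψ_central : ∀ ρ : ℝ, 0 < ρ → IsCentral μ (ψ ρ)) :
    (∀ φ ∈ L2ZeroSpace μ Gp x₀, ∀ ρ : ℝ, 0 < ρ → ∀ x : X,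
      Integrable (fun h : G => φ (h • x) * star (ψ ρ h)) μ) ∧
    ∃ W : L2ZeroSpace μ Gp x₀ →ₗᵢ[ℂ] Lp ℂ 2 ((scaleMeasure α).prod (orbitMeasure μ x₀)),
      ∀ φ : L2ZeroSpace μ Gp x₀,
        (W φ : ℝ × X → ℂ) =ᵐ[(scaleMeasure α).prod (orbitMeasure μ x₀)]
          fun q => zonalTransform μ ψ (φ : Lp ℂ 2 (orbitMeasure μ x₀)) q.1 q.2 := by
  have : IsTopologicalGroup G := topologicalGroup_of_lieGroup 𝓘(ℝ, E) ∞
  have : SecondCountableTopology G := ChartedSpace.secondCountable_of_sigmaCompact E G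
  have : μ.IsMulRightInvariant := isMulRightInvariant_haar_of_compactSpace μ
  have : μ.IsInvInvariant := isInvInvariant_haar_of_compactSpace μ
  have hiso := fun φ : L2ZeroSpace μ Gp x₀ =>
    zonalTransform_isometric hp hα hα_pos hψ hψ_central φ.2
  have hmem : ∀ φ : L2ZeroSpace μ Gp x₀,
      MemLp (fun q : ℝ × X => zonalTransform μ ψ φ.1 q.1 q.2) 2
        ((scaleMeasure α).prod (orbitMeasure μ x₀)) := fun φ =>
    ⟨aestronglyMeasurable_zonalTransform hψ.aestronglyMeasurable φ.1,
      (hiso φ).trans_lt enorm_lt_top⟩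
  refine ⟨fun φ _ ρ _ x => integrable_zonalTransform (ψ ρ) φ x,
    { toFun := fun φ => (hmem φ).toLp _
      map_add' := fun φ₁ φ₂ => ?_
      map_smul' := fun c φ => ?_
      norm_map' := fun φ => ?_ }, fun φ => (hmem φ).coeFn_toLp⟩
  · rw [← MemLp.toLp_add]
    refine MemLp.toLp_congr _ _ (ae_of_all _ fun q => ?_)
    simp only [zonalTransform_eq_inner, Pi.add_apply, Submodule.coe_add, map_add, inner_add_right]
  · rw [RingHom.id_apply, ← MemLp.toLp_const_smul]
    refine MemLp.toLp_congr _ _ (ae_of_all _ fun q => ?_)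
    simp [zonalTransform_eq_inner, inner_smul_right]
  · change ‖(hmem φ).toLp _‖ = ‖φ‖
    rw [Lp.norm_toLp, hiso φ, toReal_enorm, Submodule.coe_norm]
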